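/- Let $(X,d)$ be a countable metric space that is discrete (as a topological space), with $\operatorname{diam} X = 1$ and with a basepoint $0\in X$ satisfying $d(0,p)=1$ for all $p\in X\setminus\{0\}$. Write $B_\theta(p)=\{x : d(x,p)\le\theta\}$ and $B_\theta(F)=\bigcup_{p\in F}B_\theta(p)$. An \emph{ideal} is a collection $\mathcal I$ of closed subsets of $X$ that contains $\emptyset$ and is closed under passing to closed subsets and under finite unions; $\mathcal F$ denotes the ideal of finite subsets of $X$, and $\operatorname{ulm}(\mathcal I)\supseteq\mathcal I$ is the ideal of all closed $E\subseteq X$ for which there is $\theta>0$ such that $E\cap B_\theta(F)\in\mathcal I$ for every finite $F\subseteq X$. Let $\operatorname{Lip}(X)$ be the space of Lipschitz functions $f:X\to\mathbb R$ with $f(0)=0$, normed by $\|f\|=\sup_{p\ne q}|f(p)-f(q)|/d(p,q)$. For an ideal $\mathcal I$ let $\operatorname{Lip}_{\mathcal I}(X)\subseteq\operatorname{Lip}(X)$ be the normed subspace of those $f$ whose support $\overline{\{f\neq 0\}}$ belongs to $\mathcal I$, and let $\mathcal F_{\mathcal I}(X)$ be the norm closure in the dual $\operatorname{Lip}_{\mathcal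 I}(X)^*$ of the linear span of the evaluations $\delta_p$, $p\in X$. For ideals $\mathcal I_2\subseteq\mathcal I_1$ let $R^{\mathcal I_1}_{\mathcal I_2}:\mathcal F_{\mathcal I_1}(X)\to\mathcal F_{\mathcal I_2}(X)$ be the restriction of functionals to $\operatorname{Lip}_{\mathcal I_2}(X)$ (the bounded linear map with $\delta_p\mapsto\delta_p$). \textbf{Theorem.} Let $\mathcal I$ be an ideal with $\mathcal F\subseteq\mathcal I$ such that $R^{\mathcal I}_{\mathcal F}$ is injective, and set $\mathcal J=\operatorname{ulm}(\mathcal I)$. Then $R^{\mathcal J}_{\mathcal F}$ is injective, and $R^{\mathcal J}_{\mathcal I}:\mathcal F_{\mathcal J}(X)\to\mathcal F_{\mathcal I}(X)$ is a $7$-semi-embedding: it is injective, and, with $B$ the closed unit ball of $\mathcal F_{\mathcal J}(X)$, $\overline{R^{\mathcal J}_{\mathcal I}(B)}\subseteq R^{\mathcal J}_{\mathcal I}(7B)$. -/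

import Mathlib

open TopologicalSpace

set_option maxSynthPendingDepth 3

namespace LipFree

section Ideals

variable {X : Type*} [MetricSpace X]

/-- `B_θ(F)`, the union of the closed balls of radius `θ` centred at the points of the finite
set `F`, as a closed set. -/
def finBall (θ : ℝ) (F : Finset X) : Closeds X :=
  ⟨⋃ p ∈ F, Metric.closedBall p θ,
    F.finite_toSet.isClosed_biUnion fun _ _ => Metric.isClosed_closedBall⟩

lemma finBall_mono {θ θ' : ℝ} (h : θ ≤ θ') (F : Finset X) : finBall θ F ≤ finBall θ' F := by
  intro x hx
  simp only [finBall, Closeds.coe_mk, ← SetLike.mem_coe, Set.mem_iUnion,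
    Metric.mem_closedBall, exists_prop] at hx ⊢
  obtain ⟨p, hp, hxp⟩ := hx
  exact ⟨p, hp, hxp.trans h⟩

/-- The ideal `𝓕` of finite subsets of `X` (an ideal of closed subsets is an order ideal of the
lattice `Closeds X`). -/
def finIdeal (X : Type*) [MetricSpace X] : Order.Ideal (Closeds X) where
  carrier := {A | (A : Set X).Finite}
  lower' _ _ hBA hA := Set.Finite.subset hA hBA
  nonempty' := ⟨⊥, by simp⟩
  directed' A hA B hB := ⟨A ⊔ B, by
    simpa using Set.Finite.union hA hB, le_sup_left, le_sup_right⟩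

/-- `ulm(I)`: the closed sets that are uniformly locally modeled on the ideal `I`. -/
def ulm (I : Order.Ideal (Closeds X)) : Order.Ideal (Closeds X) where
  carrier := {E | ∃ θ : ℝ, 0 < θ ∧ ∀ F : Finset X, E ⊓ finBall θ F ∈ I}
  lower' _ _ hBA := fun ⟨θ, hθ, h⟩ =>
    ⟨θ, hθ, fun F => I.lower (inf_le_inf_right _ hBA) (h F)⟩
  nonempty' := ⟨⊥, 1, one_pos, fun F => by simp⟩
  directed' := by
    rintro A ⟨θ, hθ, h⟩ B ⟨θ', hθ', h'⟩
    refine ⟨A ⊔ B, ⟨min θ θ', lt_min hθ hθ', fun F => ?_⟩, le_sup_left, le_sup_right⟩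
    rw [inf_sup_right]
    exact Order.Ideal.sup_mem
      (I.lower (inf_le_inf_left _ (finBall_mono (min_le_left _ _) F)) (h F))
      (I.lower (inf_le_inf_left _ (finBall_mono (min_le_right _ _) F)) (h' F))

lemma le_ulm (I : Order.Ideal (Closeds X)) : I ≤ ulm I := fun _ hE =>
  ⟨1, one_pos, fun _ => I.lower inf_le_left hE⟩

end Ideals

section Lip

variable {X : Type*} [MetricSpace X]

/-- The space `Lip(X)` of real Lipschitz functions on `X` that vanish at the basepoint `o`. -/
@[ext]
structure Lip (o : X) where
  toFun : X → ℝ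
  base' : toFun o = 0
  lipschitz' : ∃ K, LipschitzWith K toFun

variable {o : X}

namespace Lip

instance : CoeFun (Lip o) (fun _ => X → ℝ) := ⟨Lip.toFun⟩

lemma base (f : Lip o) : f o = 0 := f.base'

instance : Zero (Lip o) := ⟨⟨fun _ => 0, rfl, 0, LipschitzWith.const 0⟩⟩

instance : Add (Lip o) := ⟨fun f g => ⟨fun p => f p + g p, by simp [base], by
  obtain ⟨K, hK⟩ := f.lipschitz'
  obtain ⟨L, hL⟩ := g.lipschitz'
  exact ⟨K + L, hK.add hL⟩⟩⟩

instance : Neg (Lip o) := ⟨fun f => ⟨fun p => -f p, by simp [base], by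
  obtain ⟨K, hK⟩ := f.lipschitz'
  exact ⟨K, hK.neg⟩⟩⟩

instance : SMul ℝ (Lip o) := ⟨fun c f => ⟨fun p => c * f p, by simp [base], by
  obtain ⟨K, hK⟩ := f.lipschitz'
  exact ⟨‖c‖₊ * K, (lipschitzWith_smul c).comp hK⟩⟩⟩

@[simp] lemma zero_apply (p : X) : (0 : Lip o) p = 0 := rfl
@[simp] lemma add_apply (f g : Lip o) (p : X) : (f + g) p = f p + g p := rfl
@[simp] lemma neg_apply (f : Lip o) (p : X) : (-f) p = -f p := rfl
@[simp] lemma smul_apply (c : ℝ) (f : Lip o) (p : X) : (c • f) p = c * f p := rfl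

lemma ext_apply {f g : Lip o} (h : ∀ p, f p = g p) : f = g := Lip.ext (funext h)

/-- The additive group structure underlying the normed space structure below. -/
@[reducible] def addCommGroup (o : X) : AddCommGroup (Lip o) where
  add_assoc _ _ _ := ext_apply fun _ => add_assoc _ _ _
  zero_add _ := ext_apply fun _ => zero_add _
  add_zero _ := ext_apply fun _ => add_zero _
  nsmul := nsmulRec
  zsmul := zsmulRec
  neg_add_cancel _ := ext_apply fun _ => neg_add_cancel _
  add_comm _ _ := ext_apply fun _ => add_comm _ _

end Lip

/-- The Lipschitz norm `sup_{p ≠ q} |f p - f q| / d(p,q)` (the pairs `p = q` contribute `0`). -/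
noncomputable def lipNorm (f : Lip o) : ℝ := ⨆ x : X × X, |f x.1 - f x.2| / dist x.1 x.2

lemma lipNorm_bdd (f : Lip o) :
    BddAbove (Set.range fun x : X × X => |f x.1 - f x.2| / dist x.1 x.2) := by
  obtain ⟨K, hK⟩ := f.lipschitz'
  refine ⟨K, ?_⟩
  rintro _ ⟨x, rfl⟩
  exact div_le_of_le_mul₀ dist_nonneg K.2 (hK.dist_le_mul x.1 x.2)

lemma lipNorm_nonneg (f : Lip o) : 0 ≤ lipNorm f :=
  Real.iSup_nonneg fun _ => div_nonneg (abs_nonneg _) dist_nonneg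

lemma abs_sub_le_lipNorm (f : Lip o) (p q : X) : |f p - f q| ≤ lipNorm f * dist p q := by
  rcases eq_or_ne p q with rfl | h
  · simp
  · rw [← div_le_iff₀ (dist_pos.2 h)]
    exact le_ciSup (lipNorm_bdd f) (p, q)

lemma lipNorm_le {f : Lip o} {C : ℝ} (hC : 0 ≤ C) (h : ∀ p q, |f p - f q| ≤ C * dist p q) :
    lipNorm f ≤ C :=
  Real.iSup_le (fun x => div_le_of_le_mul₀ dist_nonneg hC (h x.1 x.2)) hC

noncomputable instance : NormedAddCommGroup (Lip o) :=
  letI := Lip.addCommGroup o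
  AddGroupNorm.toNormedAddCommGroup
    { toFun := lipNorm
      map_zero' := le_antisymm (lipNorm_le le_rfl (by simp)) (lipNorm_nonneg _)
      add_le' := fun f g => lipNorm_le (add_nonneg (lipNorm_nonneg f) (lipNorm_nonneg g))
        fun p q => by
          have hf := abs_sub_le_lipNorm f p q
          have hg := abs_sub_le_lipNorm g p q
          have := abs_add_le (f p - f q) (g p - g q)
          simp only [Lip.add_apply]
          rw [add_sub_add_comm, add_mul]
          linarith
      neg' := fun f => by
        unfold lipNorm
        congr 1
        funext x
        simp only [Lip.neg_apply]
        rw [← abs_neg]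
        congr 2
        ring
      eq_zero_of_map_eq_zero' := fun f hf => by
        refine Lip.ext_apply fun p => ?_
        have := abs_sub_le_lipNorm f p o
        rw [hf, f.base, zero_mul, sub_zero] at this
        simpa using this }

lemma Lip.norm_def (f : Lip o) : ‖f‖ = lipNorm f := rfl

noncomputable instance : NormedSpace ℝ (Lip o) where
  one_smul _ := Lip.ext_apply fun _ => one_mul _
  mul_smul _ _ _ := Lip.ext_apply fun _ => mul_assoc _ _ _
  smul_zero _ := Lip.ext_apply fun _ => mul_zero _
  smul_add _ _ _ := Lip.ext_apply fun _ => mul_add _ _ _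
  add_smul _ _ _ := Lip.ext_apply fun _ => add_mul _ _ _
  zero_smul _ := Lip.ext_apply fun _ => zero_mul _
  norm_smul_le c f := lipNorm_le (mul_nonneg (norm_nonneg c) (lipNorm_nonneg f)) fun p q => by
    rw [Lip.smul_apply, Lip.smul_apply, ← mul_sub, abs_mul, mul_assoc]
    exact mul_le_mul_of_nonneg_left (abs_sub_le_lipNorm f p q) (abs_nonneg c)

/-- `supp f`, the closure of `{x | f x ≠ 0}`. -/
def supp (f : Lip o) : Closeds X := ⟨tsupport (f : X → ℝ), isClosed_tsupport _⟩

/-- `Lip_I(X)`: the subspace of all `f` in `Lip(X)` with `supp f ∈ I`, with the norm of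
`Lip(X)`. -/
def LipI (o : X) (I : Order.Ideal (Closeds X)) : Submodule ℝ (Lip o) where
  carrier := {f | supp f ∈ I}
  zero_mem' := by
    have h : supp (0 : Lip o) = ⊥ := by
      ext x
      change x ∈ tsupport (fun _ : X => (0 : ℝ)) ↔ x ∈ (∅ : Set X)
      simp [tsupport]
    change supp (0 : Lip o) ∈ I
    rw [h]
    exact I.bot_mem
  add_mem' {f g} hf hg := I.lower (a := supp f ⊔ supp g)
    (tsupport_add (f : X → ℝ) (g : X → ℝ)) (Order.Ideal.sup_mem hf hg)
  smul_mem' c f hf := I.lower (a := supp f)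
    (closure_mono fun x hx h => hx (by simp [h])) hf

/-- The functional `δ_p : f ↦ f p` on `Lip_I(X)`. -/
noncomputable def delta (o : X) (I : Order.Ideal (Closeds X)) (p : X) :
    StrongDual ℝ (LipI o I) :=
  LinearMap.mkContinuous
    { toFun := fun f => (f : Lip o) p
      map_add' := fun _ _ => rfl
      map_smul' := fun _ _ => rfl }
    (dist p o) fun f => by
      have := abs_sub_le_lipNorm (f : Lip o) p o
      rw [Lip.base, sub_zero, mul_comm] at this
      exact this

@[simp] lemma delta_apply (o : X) (I : Order.Ideal (Closeds X)) (p : X) (f : LipI o I) :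
    delta o I p f = (f : Lip o) p := rfl

/-- `ℱ_I(X)`: the closure, in the dual of `Lip_I(X)`, of the linear span of `{δ_p | p ∈ X}`,
with the dual norm. -/
noncomputable def FreeI (o : X) (I : Order.Ideal (Closeds X)) :
    Submodule ℝ (StrongDual ℝ (LipI o I)) :=
  (Submodule.span ℝ (Set.range (delta o I))).topologicalClosure

/-- The inclusion `Lip_I(X) ⊆ Lip_J(X)` for ideals `I ⊆ J`. -/
noncomputable def inclLip (o : X) {I J : Order.Ideal (Closeds X)} (h : I ≤ J) :
    LipI o I →L[ℝ] LipI o J :=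
  LinearMap.mkContinuous (Submodule.inclusion fun _ hf => h hf) 1 fun f => by
    rw [one_mul]
    exact le_rfl

/-- Restriction of functionals from `Lip_J(X)` to `Lip_I(X)`, for ideals `I ⊆ J`. -/
noncomputable def restrDual (o : X) {I J : Order.Ideal (Closeds X)} (h : I ≤ J) :
    StrongDual ℝ (LipI o J) →L[ℝ] StrongDual ℝ (LipI o I) :=
  ContinuousLinearMap.precomp ℝ (inclLip o h)

@[simp] lemma restrDual_apply (o : X) {I J : Order.Ideal (Closeds X)} (h : I ≤ J)
    (v : StrongDual ℝ (LipI o J)) (f : LipI o I) : restrDual o h v f = v (inclLip o h f) := rfl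

lemma restrDual_delta (o : X) {I J : Order.Ideal (Closeds X)} (h : I ≤ J) (p : X) :
    restrDual o h (delta o J p) = delta o I p := rfl

lemma restrDual_mem (o : X) {I J : Order.Ideal (Closeds X)} (h : I ≤ J)
    {v : StrongDual ℝ (LipI o J)} (hv : v ∈ FreeI o J) : restrDual o h v ∈ FreeI o I := by
  have hmaps : Set.MapsTo (restrDual o h) (Submodule.span ℝ (Set.range (delta o J)))
      (Submodule.span ℝ (Set.range (delta o I))) := by
    intro w hw
    induction hw using Submodule.span_induction with
    | mem w hw =>
      obtain ⟨p, rfl⟩ := hw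
      exact Submodule.subset_span ⟨p, rfl⟩
    | zero => simp
    | add x y _ _ hx hy => rw [map_add]; exact Submodule.add_mem _ hx hy
    | smul c x _ hx => rw [map_smul]; exact Submodule.smul_mem _ c hx
  exact hmaps.closure (restrDual o h).continuous hv

/-- The restriction map `R^J_I : ℱ_J(X) → ℱ_I(X)` for ideals `I ⊆ J`: the continuous linear map
with `δ_p ↦ δ_p`. -/
noncomputable def R (o : X) {I J : Order.Ideal (Closeds X)} (h : I ≤ J) :
    FreeI o J →L[ℝ] FreeI o I :=
  ((restrDual o h).comp (FreeI o J).subtypeL).codRestrict (FreeI o I)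
    fun v => restrDual_mem o h v.2

end Lip

open scoped Pointwise in
/-- `T` is a `K`-semi-embedding, for `K ∈ [1, ∞)`. -/
def IsSemiEmbedding {V W : Type*} [NormedAddCommGroup V] [NormedSpace ℝ V]
    [NormedAddCommGroup W] [NormedSpace ℝ W] (K : ℝ) (T : V →L[ℝ] W) : Prop :=
  1 ≤ K ∧ Function.Injective T ∧
    closure (T '' Metric.closedBall 0 1) ⊆ T '' (K • Metric.closedBall (0 : V) 1)

end LipFree

/-!
Let `I ≤ J ≤ ulm I`. If `f` is supported in `E ∈ ulm I`, multiplying it by a Lipschitz cutoff whose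
scale depends only on `E` produces `g ∈ Lip_I(X)` with the same values on any prescribed finite
set and `‖g‖ ≤ K_E ‖f‖`. Hence `|u f| ≤ K_E ‖R u‖ ‖f‖` for all `u ∈ ℱ_J(X)`. This gives injectivity
of `R`, and shows that a bounded sequence in `ℱ_J(X)` with norm convergent restrictions converges
uniformly on the bounded sets of functions supported in `E`, for each `E ∈ J` separately. Its
pointwise limit is therefore locally tight, and it remains to see that locally tight functionals
are globally tight, that is, lie in `ℱ_J(X)`. This is a gliding hump argument: as
`‖f ⊔ g‖ ≤ max ‖f‖ ‖g‖`, humps can be glued without leaving the unit ball. No factor is lost, which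
is why the constant is `1` in place of `7`.
-/

namespace LipFree

open Filter Topology
open scoped NNReal

lemma lipschitzWith_mul_of_nnnorm_le {Y A : Type*} [PseudoMetricSpace Y]
    [NonUnitalSeminormedRing A] {f g : Y → A} {Kf Kg Bf Bg : ℝ≥0} (hf : LipschitzWith Kf f)
    (hg : LipschitzWith Kg g) (hfB : ∀ y, ‖f y‖₊ ≤ Bf) (hgB : ∀ y, ‖g y‖₊ ≤ Bg) :
    LipschitzWith (Kf * Bg + Bf * Kg) fun y => f y * g y := by
  refine LipschitzWith.of_dist_le_mul fun x y => ?_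
  have hsplit : f x * g x - f y * g y = (f x - f y) * g x + f y * (g x - g y) := by noncomm_ring
  calc dist (f x * g x) (f y * g y)
      = ‖(f x - f y) * g x + f y * (g x - g y)‖ := by rw [dist_eq_norm, hsplit]
    _ ≤ ‖f x - f y‖ * ‖g x‖ + ‖f y‖ * ‖g x - g y‖ :=
      (norm_add_le _ _).trans (add_le_add (norm_mul_le _ _) (norm_mul_le _ _))
    _ ≤ Kf * dist x y * Bg + Bf * (Kg * dist x y) := by
      gcongr
      · rw [← dist_eq_norm]; exact hf.dist_le_mul x y
      · exact hgB x
      · exact hfB y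
      · rw [← dist_eq_norm]; exact hg.dist_le_mul x y
    _ = ↑(Kf * Bg + Bf * Kg) * dist x y := by push_cast; ring

lemma exists_lipschitzWith_eq_one_eq_zero {α : Type*} [PseudoEMetricSpace α] {θ : ℝ}
    (hθ : 0 < θ) (S : Set α) :
    ∃ φ : α → ℝ, LipschitzWith θ.toNNReal⁻¹ φ ∧ (∀ p, ‖φ p‖₊ ≤ 1) ∧ (∀ p ∈ S, φ p = 1) ∧
      ∀ p ∉ Metric.thickening θ S, φ p = 0 := by
  refine ⟨fun p => thickenedIndicator hθ S p,
    fun p q => lipschitzWith_thickenedIndicator hθ S p q,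
    fun p => ?_, fun p hp => ?_, fun p hp => ?_⟩
  · rw [NNReal.nnnorm_eq]
    exact thickenedIndicator_le_one hθ S p
  · simp only [thickenedIndicator_one hθ S hp, NNReal.coe_one]
  · simp only [thickenedIndicator_zero hθ S hp, NNReal.coe_zero]

section SemiEmbedding

variable {V W : Type*} [NormedAddCommGroup V] [NormedSpace ℝ V] [NormedAddCommGroup W]
  [NormedSpace ℝ W]

lemma IsSemiEmbedding.mono {K L : ℝ} {T : V →L[ℝ] W} (hKL : K ≤ L) (hT : IsSemiEmbedding K T) :
    IsSemiEmbedding L T := by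
  obtain ⟨hK, hinj, hcl⟩ := hT
  refine ⟨hK.trans hKL, hinj, hcl.trans (Set.image_mono ?_)⟩
  have hK0 : 0 ≤ K := zero_le_one.trans hK
  rw [smul_unitClosedBall_of_nonneg hK0, smul_unitClosedBall_of_nonneg (hK0.trans hKL)]
  exact Metric.closedBall_subset_closedBall hKL

end SemiEmbedding

section Lattice

variable {X : Type*} [MetricSpace X] {o : X}

namespace Lip

lemma nnnorm_le_iff_lipschitzWith {f : Lip o} {K : ℝ≥0} : ‖f‖₊ ≤ K ↔ LipschitzWith K f where
  mp h := LipschitzWith.of_dist_le_mul fun p q =>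
    (abs_sub_le_lipNorm f p q).trans (mul_le_mul_of_nonneg_right h dist_nonneg)
  mpr h := lipNorm_le K.2 h.dist_le_mul

lemma lipschitzWith_nnnorm (f : Lip o) : LipschitzWith ‖f‖₊ f :=
  nnnorm_le_iff_lipschitzWith.1 le_rfl

lemma nnnorm_apply_le {D : ℝ≥0} (hD : ∀ p, nndist p o ≤ D) (f : Lip o) (p : X) :
    ‖f p‖₊ ≤ ‖f‖₊ * D :=
  calc ‖f p‖₊ = nndist (f p) (f o) := by rw [f.base, nndist_zero_right]
    _ ≤ ‖f‖₊ * nndist p o := f.lipschitzWith_nnnorm.nndist_le p o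
    _ ≤ ‖f‖₊ * D := by gcongr; exact hD p

instance : LE (Lip o) := ⟨fun f g => (f : X → ℝ) ≤ g⟩

instance : LT (Lip o) := ⟨fun f g => (f : X → ℝ) < g⟩

instance : Max (Lip o) := ⟨fun f g => ⟨fun p => max (f p) (g p), by simp [base], _,
  f.lipschitzWith_nnnorm.max g.lipschitzWith_nnnorm⟩⟩

instance : Min (Lip o) := ⟨fun f g => ⟨fun p => min (f p) (g p), by simp [base], _,
  f.lipschitzWith_nnnorm.min g.lipschitzWith_nnnorm⟩⟩

/-- The pointwise order on `Lip(X)`. The Lipschitz norm is not monotone for it, so `Lip(X)` is no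
normed lattice; what survives is `‖f ⊔ g‖ ≤ max ‖f‖ ‖g‖`. -/
instance : Lattice (Lip o) :=
  Function.Injective.lattice Lip.toFun (fun _ _ => Lip.ext) Iff.rfl Iff.rfl
    (fun _ _ => rfl) (fun _ _ => rfl)

instance : IsOrderedAddMonoid (Lip o) where
  add_le_add_left _ _ hfg h p := add_le_add_left (hfg p) (h p)

@[simp] lemma sup_apply (f g : Lip o) (p : X) : (f ⊔ g) p = max (f p) (g p) := rfl

@[simp] lemma inf_apply (f g : Lip o) (p : X) : (f ⊓ g) p = min (f p) (g p) := rfl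

lemma norm_sup_le (f g : Lip o) : ‖f ⊔ g‖ ≤ max ‖f‖ ‖g‖ := by
  have hnn : ‖f ⊔ g‖₊ ≤ max ‖f‖₊ ‖g‖₊ :=
    nnnorm_le_iff_lipschitzWith.2 (f.lipschitzWith_nnnorm.max g.lipschitzWith_nnnorm)
  exact_mod_cast hnn

lemma norm_inf_le (f g : Lip o) : ‖f ⊓ g‖ ≤ max ‖f‖ ‖g‖ := by
  have hnn : ‖f ⊓ g‖₊ ≤ max ‖f‖₊ ‖g‖₊ :=
    nnnorm_le_iff_lipschitzWith.2 (f.lipschitzWith_nnnorm.min g.lipschitzWith_nnnorm)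
  exact_mod_cast hnn

lemma norm_posPart_le (f : Lip o) : ‖f⁺‖ ≤ ‖f‖ := by
  simpa only [posPart_def, norm_zero, max_eq_left (norm_nonneg f)] using norm_sup_le f 0

lemma norm_negPart_le (f : Lip o) : ‖f⁻‖ ≤ ‖f‖ := by
  simpa only [posPart_neg, norm_neg] using norm_posPart_le (-f)

end Lip

lemma supp_le_iff {f : Lip o} {E : Closeds X} : supp f ≤ E ↔ ∀ p, f p ≠ 0 → p ∈ E :=
  E.isClosed.closure_subset_iff

lemma mem_supp {f : Lip o} {p : X} (h : f p ≠ 0) : p ∈ supp f := supp_le_iff.1 le_rfl p h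

lemma supp_sup_le (f g : Lip o) : supp (f ⊔ g) ≤ supp f ⊔ supp g :=
  supp_le_iff.2 fun p hp => by
    by_cases hf : f p = 0
    · exact Or.inr (mem_supp fun hg => hp (by simp [hf, hg]))
    · exact Or.inl (mem_supp hf)

lemma supp_inf_le (f g : Lip o) : supp (f ⊓ g) ≤ supp f ⊔ supp g :=
  supp_le_iff.2 fun p hp => by
    by_cases hf : f p = 0
    · exact Or.inr (mem_supp fun hg => hp (by simp [hf, hg]))
    · exact Or.inl (mem_supp hf)

lemma supp_inf_le_left {f g : Lip o} (hg : 0 ≤ g) : supp (f ⊓ g) ≤ supp f :=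
  supp_le_iff.2 fun p hp => mem_supp fun hf => hp <| by
    rw [Lip.inf_apply, hf]
    exact min_eq_left (hg p)

variable {I : Order.Ideal (Closeds X)}

instance : Lattice (LipI o I) :=
  Subtype.lattice
    (fun f g hf hg => I.lower (supp_sup_le f g) (Order.Ideal.sup_mem hf hg))
    (fun f g hf hg => I.lower (supp_inf_le f g) (Order.Ideal.sup_mem hf hg))

end Lattice

section Cutoff

variable {X : Type*} [MetricSpace X] {o : X}

lemma exists_mul_lipschitzWith {D L : ℝ≥0} (hD : ∀ p, nndist p o ≤ D) {φ : X → ℝ}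
    (hφ : LipschitzWith L φ) (hφ1 : ∀ p, ‖φ p‖₊ ≤ 1) (f : Lip o) :
    ∃ g : Lip o, (∀ p, g p = f p * φ p) ∧ ‖g‖ ≤ ↑(1 + D * L) * ‖f‖ := by
  have hlip := lipschitzWith_mul_of_nnnorm_le f.lipschitzWith_nnnorm hφ (f.nnnorm_apply_le hD) hφ1
  refine ⟨⟨fun p => f p * φ p, by simp [Lip.base], _, hlip⟩, fun _ => rfl, ?_⟩
  refine (NNReal.coe_le_coe.2 (Lip.nnnorm_le_iff_lipschitzWith.2 hlip)).trans_eq ?_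
  push_cast
  ring

lemma thickening_finset_subset_finBall (θ : ℝ) (F : Finset X) :
    Metric.thickening θ (F : Set X) ⊆ finBall θ F := by
  intro p hp
  obtain ⟨q, hq, hpq⟩ := Metric.mem_thickening_iff.1 hp
  exact Set.mem_biUnion hq (Metric.mem_closedBall.2 hpq.le)

lemma exists_lipI_eqOn_finset [BoundedSpace X] (o : X) {I : Order.Ideal (Closeds X)}
    {E : Closeds X} (hE : E ∈ ulm I) :
    ∃ K : ℝ≥0, ∀ f : Lip o, supp f ≤ E → ∀ F : Finset X,
      ∃ g : LipI o I, (∀ p ∈ F, (g : Lip o) p = f p) ∧ ‖g‖ ≤ K * ‖f‖ := by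
  obtain ⟨θ, hθ, hEI⟩ := hE
  obtain ⟨D, hD⟩ := (Metric.isBounded_iff_nndist (s := Set.univ)).1
    (Bornology.IsBounded.all (Set.univ : Set X))
  refine ⟨1 + D * θ.toNNReal⁻¹, fun f hf F => ?_⟩
  obtain ⟨φ, hφ, hφ1, hφF, hφ0⟩ := exists_lipschitzWith_eq_one_eq_zero hθ (F : Set X)
  obtain ⟨g, hg, hgn⟩ := exists_mul_lipschitzWith (fun p => hD trivial trivial) hφ hφ1 f
  have hsupp : supp g ≤ E ⊓ finBall θ F := supp_le_iff.2 fun p hp => by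
    rw [hg] at hp
    refine ⟨hf (mem_supp (left_ne_zero_of_mul hp)), thickening_finset_subset_finBall θ F ?_⟩
    by_contra hpF
    exact right_ne_zero_of_mul hp (hφ0 p hpF)
  refine ⟨⟨g, I.lower hsupp (hEI F)⟩, fun p hp => ?_, hgn⟩
  rw [hg, hφF p (Finset.mem_coe.2 hp), mul_one]

end Cutoff

section Tight

variable {X : Type*} [MetricSpace X] {o : X} {J : Order.Ideal (Closeds X)}

lemma mem_span_delta_iff {u : StrongDual ℝ (LipI o J)} :
    u ∈ Submodule.span ℝ (Set.range (delta o J)) ↔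
      ∃ F : Finset X, ∀ f : LipI o J, (∀ p ∈ F, (f : Lip o) p = 0) → u f = 0 := by
  constructor
  · intro hu
    obtain ⟨c, rfl⟩ := Finsupp.mem_span_range_iff_exists_finsupp.1 hu
    refine ⟨c.support, fun f hf => ?_⟩
    rw [Finsupp.sum, sum_apply]
    exact Finset.sum_eq_zero fun p hp => by simp [hf p hp]
  · rintro ⟨F, hF⟩
    have hspan : u.toLinearMap ∈
        Submodule.span ℝ (Set.range fun p : F => (delta o J p).toLinearMap) :=
      mem_span_of_iInf_ker_le_ker fun f hf =>
        hF f fun p hp => (Submodule.mem_iInf _).1 hf ⟨p, hp⟩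
    obtain ⟨c, hc⟩ := (Submodule.mem_span_range_iff_exists_fun ℝ).1 hspan
    have hu : u = ∑ p : F, c p • delta o J p := by
      ext f
      simpa using (LinearMap.congr_fun hc f).symm
    rw [hu]
    exact Submodule.sum_smul_mem _ _ fun p _ => Submodule.subset_span ⟨p, rfl⟩

/-- A functional on `Lip_J(X)` is tight on the closed set `E` if, on the functions supported in
`E`, its norm can be made arbitrarily small by imposing finitely many zeros. Tightness on every
member of `J` is the local condition, and tightness on `⊤` the global condition, between which the
gliding hump argument mediates. -/
def IsTightOn (v : StrongDual ℝ (LipI o J)) (E : Closeds X) : Prop :=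
  ∀ ε : ℝ, 0 < ε → ∃ F : Finset X, ∀ g : LipI o J, supp (g : Lip o) ≤ E →
    (∀ p ∈ F, (g : Lip o) p = 0) → |v g| ≤ ε * ‖g‖

variable {v : StrongDual ℝ (LipI o J)} {E : Closeds X}

lemma IsTightOn.neg (hv : IsTightOn v E) : IsTightOn (-v) E := by
  simpa only [IsTightOn, neg_apply, abs_neg] using hv

lemma isTightOn_of_forall_exists_approx
    (h : ∀ ε : ℝ, 0 < ε → ∃ w : StrongDual ℝ (LipI o J), IsTightOn w E ∧
      ∀ g : LipI o J, supp (g : Lip o) ≤ E → |v g - w g| ≤ ε * ‖g‖) :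
    IsTightOn v E := by
  intro ε hε
  obtain ⟨w, hw, hvw⟩ := h (ε / 2) (half_pos hε)
  obtain ⟨F, hF⟩ := hw (ε / 2) (half_pos hε)
  refine ⟨F, fun g hgE hgF => ?_⟩
  calc |v g| = |v g - w g + w g| := by rw [sub_add_cancel]
    _ ≤ ε / 2 * ‖g‖ + ε / 2 * ‖g‖ :=
      (abs_add_le _ _).trans (add_le_add (hvw g hgE) (hF g hgE hgF))
    _ = ε * ‖g‖ := by ring

lemma isTightOn_of_mem_freeI (hv : v ∈ FreeI o J) (E : Closeds X) : IsTightOn v E := by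
  refine isTightOn_of_forall_exists_approx fun ε hε => ?_
  obtain ⟨s, hs, hvs⟩ := Metric.mem_closure_iff.1 hv ε hε
  obtain ⟨F, hF⟩ := mem_span_delta_iff.1 hs
  refine ⟨s, fun η hη => ⟨F, fun g _ hg => ?_⟩, fun g _ => ?_⟩
  · rw [hF g hg, abs_zero]
    positivity
  · exact (v - s).le_of_opNorm_le (by rw [← dist_eq_norm]; exact hvs.le) g

lemma IsTightOn.mem_freeI (hv : IsTightOn v ⊤) : v ∈ FreeI o J := by
  refine Metric.mem_closure_iff.2 fun ε hε => ?_
  obtain ⟨F, hF⟩ := hv (ε / 2) (half_pos hε)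
  let N : Submodule ℝ (LipI o J) := ⨅ p : F, (delta o J p).ker
  have hN : ∀ g : LipI o J, g ∈ N ↔ ∀ p ∈ F, (g : Lip o) p = 0 := fun g => by
    simp [N, Submodule.mem_iInf]
  -- A norm-preserving extension `s` of `v|_N` is small, and `v - s` is a combination of the `δ_p`.
  obtain ⟨s, hs, hsn⟩ := exists_extension_norm_eq N (v.comp N.subtypeL)
  have hs_norm : ‖s‖ ≤ ε / 2 := by
    rw [hsn]
    exact ContinuousLinearMap.opNorm_le_bound _ (half_pos hε).le fun g =>
      hF g le_top ((hN g).1 g.2)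
  refine ⟨v - s, mem_span_delta_iff.2 ⟨F, fun f hf => ?_⟩, ?_⟩
  · exact sub_eq_zero.2 (hs ⟨f, (hN f).2 hf⟩).symm
  · rw [dist_eq_norm, sub_sub_cancel]
    linarith

end Tight

section GlidingHump

variable {X : Type*} [MetricSpace X] {o : X} {J : Order.Ideal (Closeds X)}
  {v : StrongDual ℝ (LipI o J)}

lemma exists_finset_forall_nonneg_apply_le (hv : ∀ E ∈ J, IsTightOn v E) {δ : ℝ} (hδ : 0 < δ) :
    ∃ F : Finset X, ∀ g : LipI o J, 0 ≤ g → ‖g‖ ≤ 1 → (∀ p ∈ F, (g : Lip o) p = 0) →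
      v g ≤ δ := by
  by_contra! hump
  -- A hump far from an almost maximal `h` could be glued to `h` without leaving the unit ball.
  let S : Set ℝ := v '' {h | 0 ≤ h ∧ ‖h‖ ≤ 1}
  have hS : BddAbove S := ⟨‖v‖, by
    rintro _ ⟨h, ⟨-, hh⟩, rfl⟩
    exact (le_abs_self _).trans (v.unit_le_opNorm h hh)⟩
  have hS0 : S.Nonempty := ⟨v 0, 0, ⟨le_rfl, by simp⟩, rfl⟩
  obtain ⟨_, ⟨h, ⟨h0, h1⟩, rfl⟩, hmax⟩ := exists_lt_of_lt_csSup hS0 (sub_lt_self _ (half_pos hδ))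
  obtain ⟨F, hF⟩ := hv (supp (h : Lip o)) h.2 (δ / 2) (half_pos hδ)
  obtain ⟨g, g0, g1, hgF, hg⟩ := hump F
  have hsup : v (h ⊔ g) ≤ sSup S :=
    le_csSup hS ⟨_, ⟨le_sup_of_le_left h0, (Lip.norm_sup_le _ _).trans (max_le h1 g1)⟩, rfl⟩
  have hinf : |v (h ⊓ g)| ≤ δ / 2 := by
    have hnorm : ‖h ⊓ g‖ ≤ 1 := (Lip.norm_inf_le _ _).trans (max_le h1 g1)
    have hzero : ∀ p ∈ F, ((h ⊓ g : LipI o J) : Lip o) p = 0 := fun p hp =>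
      (min_eq_right ((hgF p hp).trans_le (h0 p))).trans (hgF p hp)
    exact (hF _ (supp_inf_le_left g0) hzero).trans (mul_le_of_le_one_right (half_pos hδ).le hnorm)
  have hadd : v (h ⊓ g) + v (h ⊔ g) = v h + v g := by
    rw [← map_add, inf_add_sup, map_add]
  linarith [le_abs_self (v (h ⊓ g))]

lemma exists_finset_forall_nonneg_apply_le_mul_norm (hv : ∀ E ∈ J, IsTightOn v E) {δ : ℝ}
    (hδ : 0 < δ) :
    ∃ F : Finset X, ∀ g : LipI o J, 0 ≤ g → (∀ p ∈ F, (g : Lip o) p = 0) → v g ≤ δ * ‖g‖ := by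
  obtain ⟨F, hF⟩ := exists_finset_forall_nonneg_apply_le hv hδ
  refine ⟨F, fun g g0 hgF => ?_⟩
  rcases eq_or_ne g 0 with rfl | hg
  · simp
  have hunit : v (‖g‖⁻¹ • g) ≤ δ :=
    hF _ (fun p => mul_nonneg (inv_nonneg.2 (norm_nonneg g)) (g0 p)) (norm_smul_inv_norm hg).le
      fun p hp => mul_eq_zero_of_right _ (hgF p hp)
  rwa [map_smul, smul_eq_mul, inv_mul_le_iff₀ (norm_pos_iff.2 hg), mul_comm] at hunit

lemma isTightOn_top_of_forall_mem (hv : ∀ E ∈ J, IsTightOn v E) : IsTightOn v ⊤ := by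
  classical
  intro ε hε
  obtain ⟨F, hF⟩ := exists_finset_forall_nonneg_apply_le_mul_norm hv (half_pos hε)
  obtain ⟨G, hG⟩ := exists_finset_forall_nonneg_apply_le_mul_norm
    (fun E hE => (hv E hE).neg) (half_pos hε)
  have habs : ∀ g : LipI o J, 0 ≤ g → (∀ p ∈ F ∪ G, (g : Lip o) p = 0) →
      |v g| ≤ ε / 2 * ‖g‖ := fun g g0 hg =>
    abs_le'.2 ⟨hF g g0 fun p hp => hg p (Finset.mem_union_left _ hp),
      hG g g0 fun p hp => hg p (Finset.mem_union_right _ hp)⟩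
  refine ⟨F ∪ G, fun g _ hg => ?_⟩
  have hpos : |v g⁺| ≤ ε / 2 * ‖g‖ :=
    (habs g⁺ (posPart_nonneg g) fun p hp => by
      change max ((g : Lip o) p) 0 = 0
      rw [hg p hp, max_self]).trans (by gcongr; exact Lip.norm_posPart_le _)
  have hneg : |v g⁻| ≤ ε / 2 * ‖g‖ :=
    (habs g⁻ (negPart_nonneg g) fun p hp => by
      change max (-(g : Lip o) p) 0 = 0
      rw [hg p hp, neg_zero, max_self]).trans (by gcongr; exact Lip.norm_negPart_le _)
  calc |v g| = |v g⁺ - v g⁻| := by rw [← map_sub, posPart_sub_negPart]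
    _ ≤ |v g⁺| + |v g⁻| := abs_sub _ _
    _ ≤ ε * ‖g‖ := by linarith

theorem mem_freeI_iff_forall_isTightOn : v ∈ FreeI o J ↔ ∀ E ∈ J, IsTightOn v E where
  mp hv E _ := isTightOn_of_mem_freeI hv E
  mpr hv := (isTightOn_top_of_forall_mem hv).mem_freeI

end GlidingHump

section Restriction

variable {X : Type*} [MetricSpace X] [BoundedSpace X] {o : X} {I J : Order.Ideal (Closeds X)}

lemma exists_abs_apply_le_mul_norm_restrDual (hIJ : I ≤ J) {E : Closeds X} (hE : E ∈ ulm I) :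
    ∃ K : ℝ≥0, ∀ u ∈ FreeI o J, ∀ f : LipI o J, supp (f : Lip o) ≤ E →
      |u f| ≤ K * ‖restrDual o hIJ u‖ * ‖f‖ := by
  obtain ⟨K, hK⟩ := exists_lipI_eqOn_finset o hE
  refine ⟨K, fun u hu f hf => ?_⟩
  have hclosed : IsClosed {u : StrongDual ℝ (LipI o J) |
      |u f| ≤ K * ‖restrDual o hIJ u‖ * ‖f‖} := isClosed_le (by fun_prop) (by fun_prop)
  refine closure_minimal (fun s hs => ?_) hclosed hu
  obtain ⟨F, hF⟩ := mem_span_delta_iff.1 hs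
  obtain ⟨g, hgF, hg⟩ := hK f hf F
  have hsfg : s f = s (inclLip o hIJ g) := by
    rw [← sub_eq_zero, ← map_sub]
    refine hF _ fun p hp => ?_
    change (f : Lip o) p + -(g : Lip o) p = 0
    rw [hgF p hp, add_neg_cancel]
  calc |s f| = |restrDual o hIJ s g| := by rw [hsfg, restrDual_apply]
    _ ≤ ‖restrDual o hIJ s‖ * (K * ‖f‖) := (restrDual o hIJ s).le_opNorm_of_le hg
    _ = K * ‖restrDual o hIJ s‖ * ‖f‖ := by ring

theorem R_injective_of_le_ulm (hIJ : I ≤ J) (hJ : J ≤ ulm I) :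
    Function.Injective (R o hIJ) := by
  refine (injective_iff_map_eq_zero _).2 fun u hu =>
    Subtype.ext (ContinuousLinearMap.ext fun f => ?_)
  obtain ⟨K, hK⟩ := exists_abs_apply_le_mul_norm_restrDual (o := o) hIJ (hJ f.2)
  have hu' : restrDual o hIJ (u : StrongDual ℝ (LipI o J)) = 0 := congrArg Subtype.val hu
  simpa [hu'] using hK u u.2 f le_rfl

variable {v : ℕ → StrongDual ℝ (LipI o J)}

lemma exists_forall_abs_sub_apply_le_of_cauchySeq_restrDual (hIJ : I ≤ J)
    (hv : ∀ n, v n ∈ FreeI o J) (hcauchy : CauchySeq fun n => restrDual o hIJ (v n))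
    {E : Closeds X} (hE : E ∈ ulm I) {ε : ℝ} (hε : 0 < ε) :
    ∃ N, ∀ n ≥ N, ∀ f : LipI o J, supp (f : Lip o) ≤ E → |v n f - v N f| ≤ ε * ‖f‖ := by
  obtain ⟨K, hK⟩ := exists_abs_apply_le_mul_norm_restrDual (o := o) hIJ hE
  obtain ⟨N, hN⟩ := Metric.cauchySeq_iff'.1 hcauchy (ε / (K + 1)) (by positivity)
  refine ⟨N, fun n hn f hf => ?_⟩
  have hdist : K * ‖restrDual o hIJ (v n - v N)‖ ≤ ε := by
    rw [map_sub, ← dist_eq_norm]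
    calc K * dist _ _ ≤ (K + 1) * (ε / (K + 1)) := by
          gcongr
          · exact le_add_of_nonneg_right zero_le_one
          · exact (hN n hn).le
      _ = ε := by field_simp
  exact (hK _ (Submodule.sub_mem _ (hv n) (hv N)) f hf).trans (by gcongr)

lemma exists_forall_tendsto_apply (hIJ : I ≤ J) (hJ : J ≤ ulm I) (hv : ∀ n, v n ∈ FreeI o J)
    (hcauchy : CauchySeq fun n => restrDual o hIJ (v n)) {C : ℝ} (hC : ∀ n, ‖v n‖ ≤ C) :
    ∃ u : StrongDual ℝ (LipI o J), ‖u‖ ≤ C ∧ ∀ f, Tendsto (fun n => v n f) atTop (𝓝 (u f)) := by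
  have hcauchy_apply : ∀ f, CauchySeq fun n => v n f := fun f =>
    Metric.cauchySeq_iff'.2 fun ε hε => by
      obtain ⟨N, hN⟩ := exists_forall_abs_sub_apply_le_of_cauchySeq_restrDual hIJ hv hcauchy
        (hJ f.2) (ε := ε / (‖f‖ + 1)) (by positivity)
      refine ⟨N, fun n hn => (hN n hn f le_rfl).trans_lt ?_⟩
      rw [div_mul_eq_mul_div, div_lt_iff₀ (by positivity)]
      gcongr
      exact lt_add_one _
  choose φ hφ using fun f => cauchySeq_tendsto_of_complete (hcauchy_apply f)
  obtain ⟨u, hu, rfl⟩ := (ContinuousLinearMap.isClosed_image_coe_closedBall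
    (0 : StrongDual ℝ (LipI o J)) C).mem_of_tendsto (tendsto_pi_nhds.2 hφ)
    (Eventually.of_forall fun n => ⟨v n, mem_closedBall_zero_iff.2 (hC n), rfl⟩)
  exact ⟨u, mem_closedBall_zero_iff.1 hu, hφ⟩

lemma mem_freeI_of_tendsto_apply (hIJ : I ≤ J) (hJ : J ≤ ulm I) (hv : ∀ n, v n ∈ FreeI o J)
    (hcauchy : CauchySeq fun n => restrDual o hIJ (v n)) {u : StrongDual ℝ (LipI o J)}
    (hu : ∀ f, Tendsto (fun n => v n f) atTop (𝓝 (u f))) : u ∈ FreeI o J := by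
  refine mem_freeI_iff_forall_isTightOn.2 fun E hE =>
    isTightOn_of_forall_exists_approx fun ε hε => ?_
  obtain ⟨N, hN⟩ :=
    exists_forall_abs_sub_apply_le_of_cauchySeq_restrDual hIJ hv hcauchy (hJ hE) hε
  refine ⟨v N, isTightOn_of_mem_freeI (hv N) E, fun g hg => ?_⟩
  exact le_of_tendsto ((hu g).sub_const _).abs
    ((eventually_ge_atTop N).mono fun n hn => hN n hn g hg)

theorem closure_R_image_closedBall_subset (hIJ : I ≤ J) (hJ : J ≤ ulm I) (C : ℝ) :
    closure (R o hIJ '' Metric.closedBall 0 C) ⊆ R o hIJ '' Metric.closedBall 0 C := by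
  intro w hw
  obtain ⟨x, hx, hxw⟩ := mem_closure_iff_seq_limit.1 hw
  choose v hvC hvx using hx
  obtain rfl : (fun n => R o hIJ (v n)) = x := funext hvx
  have hlim : Tendsto (fun n => restrDual o hIJ (v n : StrongDual ℝ (LipI o J))) atTop
      (𝓝 (w : StrongDual ℝ (LipI o I))) :=
    (continuous_subtype_val.tendsto w).comp hxw
  obtain ⟨u, huC, hu⟩ := exists_forall_tendsto_apply hIJ hJ (fun n => (v n).2) hlim.cauchySeq
    fun n => mem_closedBall_zero_iff.1 (hvC n)
  have hu_mem := mem_freeI_of_tendsto_apply hIJ hJ (fun n => (v n).2) hlim.cauchySeq hu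
  refine ⟨⟨u, hu_mem⟩, mem_closedBall_zero_iff.2 huC,
    Subtype.ext (ContinuousLinearMap.ext fun f => ?_)⟩
  exact tendsto_nhds_unique (hu (inclLip o hIJ f))
    (((ContinuousLinearMap.apply ℝ ℝ f).continuous.tendsto _).comp hlim)

theorem isSemiEmbedding_one_R (hIJ : I ≤ J) (hJ : J ≤ ulm I) : IsSemiEmbedding 1 (R o hIJ) :=
  ⟨le_rfl, R_injective_of_le_ulm hIJ hJ, by
    rw [smul_unitClosedBall_of_nonneg zero_le_one]
    exact closure_R_image_closedBall_subset hIJ hJ 1⟩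

end Restriction

end LipFree

theorem mainTheorem7_general {X : Type*} [MetricSpace X] [BoundedSpace X] (o : X)
    {I₀ I J : Order.Ideal (Closeds X)} (hI₀ : I₀ ≤ I) (hIJ : I ≤ J) (hJ : J ≤ LipFree.ulm I)
    (hinj : Function.Injective (LipFree.R o hI₀)) :
    Function.Injective (LipFree.R o (hI₀.trans hIJ)) ∧
      LipFree.IsSemiEmbedding 1 (LipFree.R o hIJ) :=
  ⟨hinj.comp (LipFree.R_injective_of_le_ulm hIJ hJ), LipFree.isSemiEmbedding_one_R hIJ hJ⟩

theorem mainTheorem7 {X : Type*} [MetricSpace X] [DiscreteTopology X] [Countable X]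
    (hdiam : Metric.diam (Set.univ : Set X) = 1)
    (o : X) (ho : ∀ p : X, p ≠ o → dist o p = 1)
    (I : Order.Ideal (TopologicalSpace.Closeds X))
    (hFI : LipFree.finIdeal X ≤ I)
    (hinj : Function.Injective (LipFree.R o hFI)) :
    Function.Injective (LipFree.R o (hFI.trans (LipFree.le_ulm I))) ∧
      LipFree.IsSemiEmbedding 7 (LipFree.R o (LipFree.le_ulm I)) := by
  have : BoundedSpace X := ⟨by
    by_contra hunbounded
    exact zero_ne_one ((Metric.diam_eq_zero_of_unbounded hunbounded).symm.trans hdiam)⟩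
  exact (mainTheorem7_general o hFI (LipFree.le_ulm I) le_rfl hinj).imp_right
    (LipFree.IsSemiEmbedding.mono (by norm_num))
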